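/- Let $p,q\in[0,1]$, $0<r\le\tfrac12$ and $\lambda>0$. Consider the controlled Markov chain with states $$s_k=\frac{1}{2r}\Big[1+(1-2r)^{k+1}-2(1-r)^{k+1}\Big],\qquad k=0,1,2,\dots,$$ actions $d\in\{0,1\}$ (idle / jam), one-step reward $s-\lambda d$, and transitions from $s_k$ to $s_0$ with probability $p$ and to $s_{k+1}$ with probability $1-p$ if $d=0$, and to $s_0$ with probability $p(1-q)$ and to $s_{k+1}$ with probability $1-p(1-q)$ if $d=1$. A causal policy $\phi$ chooses $d(t)$, possibly at random, from $s(0),d(0),\dots,s(t-1),d(t-1),s(t)$; its average reward from $s(0)$ is $\liminf_{T\to\infty}\frac1T\,\mathbb E^{\phi}\big[\sum_{t=0}^{T-1}(s(t)-\lambda d(t))\,\big|\,s(0)\big]$. Then the Bellman optimality equation $$\theta+V(s)=\max_{d\in\{0,1\}}\Big\{s-\lambda d+\sum_{s'}\Pr(s\to s'\mid d)\,V(s')\Big\}\quad\text{for all states } s$$ has a solution $(\theta,V)$ with $V$ bounded. For every such solution, $\theta$ is the maximum over all causal policies of the average reward, for every initial state; there is a stationary policy that in each state prescribes an action attaining the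 maximum in the Bellman equation; and every such stationary policy attains the average reward $\theta$ from every initial state and is an increasing threshold policy: either there is an $n\in\mathbb N$ such that it prescribes $d=0$ in every state $s_k<s_n$ and $d=1$ in every state $s_k\ge s_n$, or it prescribes $d=0$ in every state (infinite threshold). -/

import Mathlib

open Filter

noncomputable section

namespace EAoII

/-- The value `s_k = (1/2r) [1 + (1-2r)^(k+1) - 2 (1-r)^(k+1)]` of the expected age of incorrect
information when `k` slots have passed since the last successful reception.  For `0 < r ≤ 1/2`
the map `k ↦ s_k` is injective, so the state `s_k` is represented below by its index `k`. -/
def eaoii (r : ℝ) (k : ℕ) : ℝ :=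
  1 / (2 * r) * (1 + (1 - 2 * r) ^ (k + 1) - 2 * (1 - r) ^ (k + 1))

/-- The law on `Bool` with mass `x` at `true` and `1 - x` at `false`. -/
def coin (x : unitInterval) : PMF Bool :=
  PMF.ofFintype
    (fun b => if b then (unitInterval.toNNReal x : ENNReal)
      else (unitInterval.toNNReal (unitInterval.symm x) : ENNReal))
    (by
      rw [Fintype.sum_bool]
      simp only [if_true, Bool.false_eq_true, if_false]
      exact_mod_cast unitInterval.toNNReal_add_toNNReal_symm x)

/-- The probability that the packet is received: `p` if the adversary is idle (`d = false`), and
`p (1 - q)` if it jams (`d = true`). -/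
def receptionProb (p q : unitInterval) (d : Bool) : unitInterval :=
  if d then p * unitInterval.symm q else p

/-- The law of the next state from `s_k` under the action `d`: `s_0` if the packet is received,
and `s_{k+1}` otherwise. -/
def transition (p q : unitInterval) (k : ℕ) (d : Bool) : PMF ℕ :=
  (coin (receptionProb p q d)).map fun received => if received then 0 else k + 1

/-- The expectation of `f` under the discrete law `μ`. -/
def expect {α : Type} (μ : PMF α) (f : α → ℝ) : ℝ :=
  ∑' a, (μ a).toReal * f a

/-- The one-step reward `s_k - lam * d`. -/
def reward (r lam : ℝ) (k : ℕ) (d : Bool) : ℝ :=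
  eaoii r k - lam * (if d then 1 else 0)

/-- What the adversary has observed when it chooses `d(t)`: the list of the past pairs
`(s(0), d(0)), …, (s(t-1), d(t-1))`, and the current state `s(t)`. -/
abbrev History : Type := List (ℕ × Bool) × ℕ

/-- A causal jamming policy: a (possibly randomized) choice of the action from the history. -/
abbrev Policy : Type := History → PMF Bool

/-- The stationary deterministic policy that plays `d k` in state `s_k`. -/
def stationary (d : ℕ → Bool) : Policy := fun h => PMF.pure (d h.2)

/-- The law of the history at time `t` under the policy `φ` with `s(0) = s_k`. -/
def historyLaw (p q : unitInterval) (φ : Policy) (k : ℕ) : ℕ → PMF History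
  | 0 => PMF.pure ([], k)
  | t + 1 => (historyLaw p q φ k t).bind fun h =>
      (φ h).bind fun d =>
        (transition p q h.2 d).map fun j => (h.1 ++ [(h.2, d)], j)

/-- The joint law of the state and the action `(s(t), d(t))` under `φ` with `s(0) = s_k`. -/
def stateActionLaw (p q : unitInterval) (φ : Policy) (k t : ℕ) : PMF (ℕ × Bool) :=
  (historyLaw p q φ k t).bind fun h => (φ h).map fun d => (h.2, d)

/-- The expected reward `E^φ[R(t) | s(0) = s_k]`. -/
def expectedReward (p q : unitInterval) (r lam : ℝ) (φ : Policy) (k t : ℕ) : ℝ :=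
  expect (stateActionLaw p q φ k t) fun x => reward r lam x.1 x.2

/-- The long-term average reward
`liminf_{T → ∞} (1/T) E^φ[∑_{t < T} R(t) | s(0) = s_k]`. -/
def averageReward (p q : unitInterval) (r lam : ℝ) (φ : Policy) (k : ℕ) : ℝ :=
  liminf (fun T : ℕ => 1 / (T : ℝ) * ∑ t ∈ Finset.range T, expectedReward p q r lam φ k t) atTop

/-- The quantity maximized in the Bellman equation at state `s_k`:
`s_k - lam * d + ∑_{s'} Pr(s_k → s' | d) V(s')`. -/
def actionValue (p q : unitInterval) (r lam : ℝ) (V : ℕ → ℝ) (k : ℕ) (d : Bool) : ℝ :=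
  reward r lam k d + expect (transition p q k d) V

/-- `(θ, V)` solves the average-reward Bellman optimality equation, with a bounded differential
reward-to-go function `V` (`V k` stands for `V(s_k)`). -/
def IsBellmanSolution (p q : unitInterval) (r lam θ : ℝ) (V : ℕ → ℝ) : Prop :=
  (∃ C : ℝ, ∀ k, |V k| ≤ C) ∧
    ∀ k, θ + V k = max (actionValue p q r lam V k false) (actionValue p q r lam V k true)

/-- The decision rule `d` prescribes in every state an action that attains the maximum in the
Bellman equation. -/
def AttainsMax (p q : unitInterval) (r lam : ℝ) (V : ℕ → ℝ) (d : ℕ → Bool) : Prop :=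
  ∀ k a, actionValue p q r lam V k a ≤ actionValue p q r lam V k (d k)

/-- `d` is an increasing threshold policy: for some finite threshold `s_n` it is idle in the states
`s_k < s_n` and jams in the states `s_k ≥ s_n`; or the threshold is infinite and it never jams. -/
def IsIncreasingThreshold (r : ℝ) (d : ℕ → Bool) : Prop :=
  (∃ n : ℕ, ∀ k, (eaoii r k < eaoii r n → d k = false) ∧ (eaoii r n ≤ eaoii r k → d k = true)) ∨
    ∀ k, d k = false

end EAoII

end

/-!
As `s_k → L := 1 / (2 r)` with a summable error, a solution `V` with `V(s_0) = 0` should converge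
too, to some `x`, and then the equation forces `θ = L + F x - x`, where
`F = continuation p q lam 0`.  Since `F` is nonexpansive, starting from `x` at a far horizon and
running the recursion backwards with this `θ` converges, uniformly in `x`, to a bounded solution
whose value at `s_0` is continuous in `x` and stays within a fixed distance of `x`; by the
intermediate value theorem some `x` makes it `0`.

Along any policy the expected reward is `θ`, plus a telescoping bounded term, minus the expected
loss `θ + V(s) - actionValue s d`.  The loss is nonnegative and vanishes for maximizing actions.

A bounded solution is strictly increasing: a descent of `V` would be followed by steeper and steeper
descents.  Hence the gain `p q (V(s_{k+1}) - V(s_0))` of jamming increases with `k`, while its cost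
`lam` is constant.
-/

open scoped Topology

noncomputable section

namespace EAoII

section Expect

variable {α β : Type}

theorem hasSum_toReal_coe (μ : PMF α) : HasSum (fun a => (μ a).toReal) 1 := by
  simpa [← ENNReal.tsum_toReal_eq μ.apply_ne_top] using
    ENNReal.hasSum_toReal μ.tsum_coe_ne_top

theorem norm_toReal_mul_le (μ : PMF α) {f : α → ℝ} {C : ℝ} (hf : ∀ a, |f a| ≤ C) (a : α) :
    ‖(μ a).toReal * f a‖ ≤ (μ a).toReal * C := by
  rw [norm_mul, Real.norm_of_nonneg ENNReal.toReal_nonneg]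
  exact mul_le_mul_of_nonneg_left (hf a) ENNReal.toReal_nonneg

theorem summable_toReal_mul (μ : PMF α) {f : α → ℝ} {C : ℝ} (hf : ∀ a, |f a| ≤ C) :
    Summable fun a => (μ a).toReal * f a :=
  ((hasSum_toReal_coe μ).summable.mul_right C).of_norm_bounded (norm_toReal_mul_le μ hf)

theorem abs_expect_le (μ : PMF α) {f : α → ℝ} {C : ℝ} (hf : ∀ a, |f a| ≤ C) :
    |expect μ f| ≤ C :=
  tsum_of_norm_bounded (by simpa using (hasSum_toReal_coe μ).mul_right C)
    (norm_toReal_mul_le μ hf)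

theorem expect_nonneg (μ : PMF α) {f : α → ℝ} (hf : ∀ a, 0 ≤ f a) : 0 ≤ expect μ f :=
  tsum_nonneg fun a => mul_nonneg ENNReal.toReal_nonneg (hf a)

theorem expect_eq_zero (μ : PMF α) {f : α → ℝ} (hf : ∀ a ∈ μ.support, f a = 0) :
    expect μ f = 0 := by
  refine (tsum_congr fun a => ?_).trans tsum_zero
  by_cases ha : a ∈ μ.support
  · rw [hf a ha, mul_zero]
  · rw [(μ.apply_eq_zero_iff a).2 ha, ENNReal.toReal_zero, zero_mul]

theorem expect_const (μ : PMF α) (c : ℝ) : expect μ (fun _ => c) = c := by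
  rw [expect, tsum_mul_right, (hasSum_toReal_coe μ).tsum_eq, one_mul]

theorem expect_sub (μ : PMF α) {f g : α → ℝ} {C D : ℝ} (hf : ∀ a, |f a| ≤ C)
    (hg : ∀ a, |g a| ≤ D) :
    expect μ (fun a => f a - g a) = expect μ f - expect μ g := by
  simp only [expect, mul_sub]
  exact (summable_toReal_mul μ hf).tsum_sub (summable_toReal_mul μ hg)

theorem expect_const_add (μ : PMF α) (c : ℝ) {f : α → ℝ} {C : ℝ} (hf : ∀ a, |f a| ≤ C) :
    expect μ (fun a => c + f a) = c + expect μ f := by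
  calc expect μ (fun a => c + f a) = expect μ (fun _ => c) + expect μ f := by
        simp only [expect, mul_add]
        exact (summable_toReal_mul μ fun _ => le_refl |c|).tsum_add (summable_toReal_mul μ hf)
    _ = c + expect μ f := by rw [expect_const]

theorem expect_pure (a : α) (f : α → ℝ) : expect (PMF.pure a) f = f a := by
  rw [expect, tsum_eq_single a fun b hb => by simp [PMF.pure_apply, hb]]
  simp

theorem toReal_bind_apply (μ : PMF α) (κ : α → PMF β) (b : β) :
    (μ.bind κ b).toReal = ∑' a, (μ a).toReal * (κ a b).toReal := by
  rw [PMF.bind_apply, ENNReal.tsum_toReal_eq fun a =>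
    ENNReal.mul_ne_top (μ.apply_ne_top a) ((κ a).apply_ne_top b)]
  simp only [ENNReal.toReal_mul]

theorem summable_toReal_mul_toReal (μ : PMF α) (κ : α → PMF β) :
    Summable fun x : α × β => (μ x.1).toReal * (κ x.1 x.2).toReal := by
  simp only [← ENNReal.toReal_mul]
  refine ENNReal.summable_toReal ?_
  rw [ENNReal.tsum_prod' (f := fun x : α × β => μ x.1 * κ x.1 x.2)]
  simp [ENNReal.tsum_mul_left]

theorem expect_bind (μ : PMF α) (κ : α → PMF β) {f : β → ℝ} {C : ℝ} (hf : ∀ b, |f b| ≤ C) :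
    expect (μ.bind κ) f = expect μ fun a => expect (κ a) f := by
  have hsum : Summable (Function.uncurry fun (a : α) (b : β) =>
      (μ a).toReal * (κ a b).toReal * f b) := by
    refine ((summable_toReal_mul_toReal μ κ).mul_right C).of_norm_bounded fun x => ?_
    rw [Function.uncurry, norm_mul, Real.norm_of_nonneg (by positivity)]
    exact mul_le_mul_of_nonneg_left (hf _) (by positivity)
  calc expect (μ.bind κ) f = ∑' b, ∑' a, (μ a).toReal * (κ a b).toReal * f b := by
        simp only [expect, toReal_bind_apply, tsum_mul_right]
    _ = ∑' a, ∑' b, (μ a).toReal * (κ a b).toReal * f b := hsum.tsum_comm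
    _ = expect μ fun a => expect (κ a) f := by
        simp only [expect, mul_assoc, tsum_mul_left]

theorem expect_map (μ : PMF α) (g : α → β) {f : β → ℝ} {C : ℝ} (hf : ∀ b, |f b| ≤ C) :
    expect (μ.map g) f = expect μ fun a => f (g a) := by
  rw [← PMF.bind_pure_comp, expect_bind μ _ hf]
  simp only [Function.comp, expect_pure]

end Expect

section Average

variable {θ c C : ℝ} {P x : ℕ → ℝ}

theorem tendsto_average_const_add_sub_succ (θ : ℝ) (hP : ∀ t, |P t| ≤ C) :
    Tendsto (fun T : ℕ => 1 / (T : ℝ) * ∑ t ∈ Finset.range T, (θ + (P t - P (t + 1)))) atTop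
      (𝓝 θ) := by
  have hz : Tendsto (fun T : ℕ => (P 0 - P T) * (1 / (T : ℝ))) atTop (𝓝 0) :=
    bdd_le_mul_tendsto_zero' (C + C)
      (Eventually.of_forall fun T => (abs_sub _ _).trans (add_le_add (hP 0) (hP T)))
      tendsto_one_div_atTop_nhds_zero_nat
  rw [← add_zero θ]
  refine (hz.const_add θ).congr' ?_
  filter_upwards [eventually_ne_atTop 0] with T hT
  rw [add_zero, Finset.sum_add_distrib, Finset.sum_range_sub', Finset.sum_const,
    Finset.card_range, nsmul_eq_mul]
  field_simp

theorem liminf_average_le (hP : ∀ t, |P t| ≤ C) (hc : ∀ t, c ≤ x t)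
    (hx : ∀ t, x t ≤ θ + (P t - P (t + 1))) :
    liminf (fun T : ℕ => 1 / (T : ℝ) * ∑ t ∈ Finset.range T, x t) atTop ≤ θ := by
  have hlim := tendsto_average_const_add_sub_succ θ hP
  have hbdd : IsBoundedUnder (· ≥ ·) atTop
      fun T : ℕ => 1 / (T : ℝ) * ∑ t ∈ Finset.range T, x t := by
    refine isBoundedUnder_of_eventually_ge (a := c) ?_
    filter_upwards [eventually_gt_atTop 0] with T hT
    rw [one_div_mul_eq_div, le_div_iff₀ (by positivity), mul_comm]
    simpa using Finset.card_nsmul_le_sum (Finset.range T) x c fun t _ => hc t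
  rw [← hlim.liminf_eq]
  exact liminf_le_liminf
    (Eventually.of_forall fun T =>
      mul_le_mul_of_nonneg_left (Finset.sum_le_sum fun t _ => hx t) (by positivity))
    hbdd hlim.isBoundedUnder_le.isCoboundedUnder_ge

end Average

section BackwardRecursion

variable {F : ℝ → ℝ} {s V : ℕ → ℝ} {L θ : ℝ}

theorem strictMono_of_bddBelow_of_descent_steepens (hV : BddBelow (Set.range V))
    (hdesc : ∀ k, V (k + 1) ≤ V k → V (k + 2) - V (k + 1) < V (k + 1) - V k) :
    StrictMono V := by
  refine strictMono_nat_of_lt_succ fun k => ?_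
  by_contra! hk
  set δ := V (k + 2) - V (k + 1) with hδ
  have hδ_neg : δ < 0 := by linarith [hdesc k hk]
  have hstep (n : ℕ) : V (k + 1 + n + 1) - V (k + 1 + n) ≤ δ := by
    induction n with
    | zero => exact hδ.ge
    | succ n ih => exact (hdesc (k + 1 + n) (by linarith)).le.trans ih
  have hdecay (n : ℕ) : V (k + 1 + n) ≤ V (k + 1) + n * δ := by
    induction n with
    | zero => simp
    | succ n ih => rw [← add_assoc (k + 1)]; push_cast; linarith [hstep n]
  have hlim : Tendsto (fun n => V (k + 1 + n)) atTop atBot :=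
    tendsto_atBot_mono hdecay (tendsto_atBot_add_const_left _ _
      (tendsto_natCast_atTop_atTop.atTop_mul_const_of_neg hδ_neg))
  exact not_bddBelow_of_tendsto_atBot hlim (hV.mono (Set.range_comp_subset_range (k + 1 + ·) V))

theorem strictMono_of_backward_recursion (hF : Monotone F) (hF' : LipschitzWith 1 F)
    (hs : StrictMono s) (hV : BddBelow (Set.range V))
    (h : ∀ k, θ + V k = s k + F (V (k + 1))) : StrictMono V := by
  refine strictMono_of_bddBelow_of_descent_steepens hV fun k hk => ?_
  have hsk : s k < s (k + 1) := hs k.lt_succ_self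
  have hlt : V (k + 2) < V (k + 1) := hF.reflect_lt (by linarith [h k, h (k + 1)])
  have hLip : |F (V (k + 1)) - F (V (k + 2))| ≤ V (k + 1) - V (k + 2) := by
    simpa [abs_of_pos (sub_pos.2 hlt)] using hF'.norm_sub_le (V (k + 1)) (V (k + 2))
  linarith [le_of_abs_le hLip, h k, h (k + 1)]

/-- The value at `k` obtained from the value `x` at `k + n` by running `n` steps of the recursion
`θ + V k = s k + F (V (k + 1))` backwards, with the constant `θ = L + F x - x` that makes `x` a
fixed point of the limiting recursion as `s k → L`. -/
def backwardIterate (F : ℝ → ℝ) (s : ℕ → ℝ) (L x : ℝ) : ℕ → ℕ → ℝ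
  | 0, _ => x
  | n + 1, k => s k - (L + F x - x) + F (backwardIterate F s L x n (k + 1))

/-- The limit of `backwardIterate F s L x n k` as `n → ∞`, written as a telescoping series. -/
def backwardLimit (F : ℝ → ℝ) (s : ℕ → ℝ) (L x : ℝ) (k : ℕ) : ℝ :=
  x + ∑' n, (backwardIterate F s L x (n + 1) k - backwardIterate F s L x n k)

theorem continuous_backwardIterate (hF : Continuous F) (n k : ℕ) :
    Continuous fun x => backwardIterate F s L x n k := by
  induction n generalizing k with
  | zero => exact continuous_id
  | succ n ih =>
    have := ih (k + 1)
    simp only [backwardIterate]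
    fun_prop

theorem norm_backwardIterate_succ_sub_le (hF : LipschitzWith 1 F) (x : ℝ) (n k : ℕ) :
    ‖backwardIterate F s L x (n + 1) k - backwardIterate F s L x n k‖ ≤ |s (k + n) - L| := by
  induction n generalizing k with
  | zero =>
    have e : s k - (L + F x - x) + F x - x = s k - L := by ring
    simp [backwardIterate, e]
  | succ n ih =>
    calc ‖backwardIterate F s L x (n + 2) k - backwardIterate F s L x (n + 1) k‖
        = ‖F (backwardIterate F s L x (n + 1) (k + 1)) -
            F (backwardIterate F s L x n (k + 1))‖ := by
          exact congrArg norm (add_sub_add_left_eq_sub _ _ _)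
      _ ≤ ‖backwardIterate F s L x (n + 1) (k + 1) - backwardIterate F s L x n (k + 1)‖ := by
          simpa using hF.norm_sub_le _ _
      _ ≤ |s (k + 1 + n) - L| := ih (k + 1)
      _ = |s (k + (n + 1)) - L| := by rw [add_right_comm, add_assoc]

theorem summable_abs_shift (hs : Summable fun k => s k - L) (k : ℕ) :
    Summable fun n => |s (k + n) - L| :=
  hs.abs.comp_injective (add_right_injective k)

theorem tendsto_backwardIterate (hF : LipschitzWith 1 F) (hs : Summable fun k => s k - L)
    (x : ℝ) (k : ℕ) :
    Tendsto (fun n => backwardIterate F s L x n k) atTop (𝓝 (backwardLimit F s L x k)) := by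
  have hsum := (summable_abs_shift hs k).of_norm_bounded fun n =>
    norm_backwardIterate_succ_sub_le hF x n k
  refine (hsum.hasSum.tendsto_sum_nat.const_add x).congr fun n => ?_
  rw [Finset.sum_range_sub (fun n => backwardIterate F s L x n k), backwardIterate,
    add_sub_cancel]

theorem backwardLimit_eq (hF : LipschitzWith 1 F) (hs : Summable fun k => s k - L)
    (x : ℝ) (k : ℕ) :
    backwardLimit F s L x k = s k - (L + F x - x) + F (backwardLimit F s L x (k + 1)) :=
  tendsto_nhds_unique ((tendsto_add_atTop_iff_nat 1).2 (tendsto_backwardIterate hF hs x k))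
    (((hF.continuous.tendsto _).comp (tendsto_backwardIterate hF hs x (k + 1))).const_add _)

theorem continuous_backwardLimit (hF : LipschitzWith 1 F) (hs : Summable fun k => s k - L)
    (k : ℕ) : Continuous fun x => backwardLimit F s L x k :=
  continuous_id.add <| continuous_tsum
    (fun n => (continuous_backwardIterate hF.continuous (n + 1) k).sub
      (continuous_backwardIterate hF.continuous n k))
    (summable_abs_shift hs k) fun n x => norm_backwardIterate_succ_sub_le hF x n k

theorem abs_backwardLimit_sub_le (hF : LipschitzWith 1 F) (hs : Summable fun k => s k - L)
    (x : ℝ) (k : ℕ) : |backwardLimit F s L x k - x| ≤ ∑' n, |s n - L| := by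
  rw [backwardLimit, add_sub_cancel_left]
  exact (tsum_of_norm_bounded (summable_abs_shift hs k).hasSum fun n =>
    norm_backwardIterate_succ_sub_le hF x n k).trans
    (tsum_comp_le_tsum_of_inj hs.abs (fun _ => abs_nonneg _) (add_right_injective k))

theorem exists_bounded_backward_recursion (hF : LipschitzWith 1 F)
    (hs : Summable fun k => s k - L) :
    ∃ (θ : ℝ) (V : ℕ → ℝ), (∃ C, ∀ k, |V k| ≤ C) ∧ V 0 = 0 ∧
      ∀ k, θ + V k = s k + F (V (k + 1)) := by
  set M := ∑' n, |s n - L|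
  have hnear (x : ℝ) (k : ℕ) := abs_le.1 (abs_backwardLimit_sub_le hF hs x k)
  obtain ⟨x, hx⟩ : (0 : ℝ) ∈ Set.range fun x => backwardLimit F s L x 0 :=
    mem_range_of_exists_le_of_exists_ge (continuous_backwardLimit hF hs 0)
      ⟨-M, by linarith [(hnear (-M) 0).2]⟩ ⟨M, by linarith [(hnear M 0).1]⟩
  refine ⟨L + F x - x, backwardLimit F s L x, ⟨|x| + M, fun k => abs_le.2 ?_⟩, hx, fun k => ?_⟩
  · constructor <;> linarith [(hnear x k).1, (hnear x k).2, neg_abs_le x, le_abs_self x]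
  · rw [backwardLimit_eq hF hs x k, ← add_assoc, add_sub_cancel]

end BackwardRecursion

section Age

variable {r : ℝ}

theorem eaoii_succ_sub (hr : r ≠ 0) (k : ℕ) :
    eaoii r (k + 1) - eaoii r k = (1 - r) ^ (k + 1) - (1 - 2 * r) ^ (k + 1) := by
  rw [eaoii, eaoii]
  field_simp
  ring

/-- The bound `2 / 3` is sharp: for `r = 2 / 3` the powers in `eaoii_succ_sub` agree for odd `k`. -/
theorem eaoii_strictMono (hr : 0 < r) (hr' : r < 2 / 3) : StrictMono (eaoii r) := by
  refine strictMono_nat_of_lt_succ fun k => ?_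
  have hbase : |1 - 2 * r| < 1 - r := abs_lt.2 ⟨by linarith, by linarith⟩
  have hpow : (1 - 2 * r) ^ (k + 1) < (1 - r) ^ (k + 1) :=
    calc (1 - 2 * r) ^ (k + 1) ≤ |1 - 2 * r| ^ (k + 1) := by rw [← abs_pow]; exact le_abs_self _
      _ < (1 - r) ^ (k + 1) := pow_lt_pow_left₀ hbase (abs_nonneg _) k.succ_ne_zero
  linarith [eaoii_succ_sub hr.ne' k]

theorem abs_eaoii_le (hr : 0 < r) (hr' : r ≤ 1) (k : ℕ) : |eaoii r k| ≤ 2 / r := by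
  have h₁ : |(1 - r) ^ (k + 1)| ≤ 1 := by
    rw [abs_pow]
    exact pow_le_one₀ (abs_nonneg _) (abs_le.2 ⟨by linarith, by linarith⟩)
  have h₂ : |(1 - 2 * r) ^ (k + 1)| ≤ 1 := by
    rw [abs_pow]
    exact pow_le_one₀ (abs_nonneg _) (abs_le.2 ⟨by linarith, by linarith⟩)
  have hsum : |1 + (1 - 2 * r) ^ (k + 1) - 2 * (1 - r) ^ (k + 1)| ≤ 4 := by
    rw [abs_le] at *
    constructor <;> linarith
  calc |eaoii r k| ≤ 1 / (2 * r) * 4 := by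
        rw [eaoii, abs_mul, abs_of_pos (by positivity)]
        gcongr
    _ = 2 / r := by ring

theorem summable_eaoii_sub (hr : 0 < r) (hr' : r < 1) :
    Summable fun k => eaoii r k - 1 / (2 * r) := by
  have h₁ := (summable_geometric_of_abs_lt_one
    (abs_lt.2 ⟨by linarith, by linarith⟩ : |1 - r| < 1)).mul_left (-(1 - r) / r)
  have h₂ := (summable_geometric_of_abs_lt_one
    (abs_lt.2 ⟨by linarith, by linarith⟩ : |1 - 2 * r| < 1)).mul_left ((1 - 2 * r) / (2 * r))
  refine (h₁.add h₂).congr fun k => ?_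
  rw [eaoii]
  field_simp
  ring

end Age

section Bellman

variable {p q : unitInterval} {r lam θ : ℝ} {V : ℕ → ℝ}

theorem expect_coin (x : unitInterval) (f : Bool → ℝ) :
    expect (coin x) f = x * f true + (1 - x) * f false := by
  simp [expect, coin, tsum_fintype]

theorem expect_transition (hV : ∃ C, ∀ k, |V k| ≤ C) (k : ℕ) (d : Bool) :
    expect (transition p q k d) V =
      receptionProb p q d * V 0 + (1 - receptionProb p q d) * V (k + 1) := by
  obtain ⟨C, hC⟩ := hV
  rw [transition, expect_map _ _ hC, expect_coin]
  simp

theorem actionValue_false (hV : ∃ C, ∀ k, |V k| ≤ C) (k : ℕ) :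
    actionValue p q r lam V k false = eaoii r k + (p * V 0 + (1 - p) * V (k + 1)) := by
  simp [actionValue, reward, expect_transition hV, receptionProb]

theorem actionValue_true (hV : ∃ C, ∀ k, |V k| ≤ C) (k : ℕ) :
    actionValue p q r lam V k true =
      actionValue p q r lam V k false + (p * q * (V (k + 1) - V 0) - lam) := by
  rw [actionValue_false hV]
  simp only [actionValue, reward, expect_transition hV, receptionProb, if_true, Set.Icc.coe_mul,
    unitInterval.coe_symm_eq]
  ring

/-- The maximum over the two actions of the expected next value, net of the cost of jamming, when
`v` is the value of `s_0` and `x` the value of the state that follows a loss of the packet. -/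
def continuation (p q : unitInterval) (lam v x : ℝ) : ℝ :=
  max (p * v + (1 - p) * x) (p * v + (1 - p) * x + (p * q * (x - v) - lam))

theorem isBellmanSolution_iff : IsBellmanSolution p q r lam θ V ↔ (∃ C, ∀ k, |V k| ≤ C) ∧
    ∀ k, θ + V k = eaoii r k + continuation p q lam (V 0) (V (k + 1)) := by
  refine and_congr_right fun hV => forall_congr' fun k => ?_
  rw [actionValue_true hV, actionValue_false hV, continuation, ← max_add_add_left, add_assoc]

theorem lipschitzWith_one_mul_add {c : ℝ} (hc : c ∈ unitInterval) (b : ℝ) :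
    LipschitzWith 1 fun x => c * x + b := by
  refine LipschitzWith.of_dist_le_mul fun x y => ?_
  rw [dist_add_right, Real.dist_eq, Real.dist_eq, ← mul_sub, abs_mul, abs_of_nonneg hc.1]
  exact mul_le_mul_of_nonneg_right hc.2 (abs_nonneg _)

theorem continuation_eq_max_affine (p q : unitInterval) (lam v x : ℝ) :
    continuation p q lam v x = max ((unitInterval.symm p : ℝ) * x + p * v)
      ((unitInterval.symm (p * unitInterval.symm q) : ℝ) * x +
        ((p * unitInterval.symm q : unitInterval) * v - lam)) := by
  simp only [continuation, Set.Icc.coe_mul, unitInterval.coe_symm_eq]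
  congr 1 <;> ring

theorem lipschitzWith_continuation (p q : unitInterval) (lam v : ℝ) :
    LipschitzWith 1 (continuation p q lam v) := by
  simpa only [← continuation_eq_max_affine, max_self] using
    (lipschitzWith_one_mul_add (unitInterval.symm p).2 (p * v)).max
      (lipschitzWith_one_mul_add (unitInterval.symm (p * unitInterval.symm q)).2
        ((p * unitInterval.symm q : unitInterval) * v - lam))

theorem continuation_monotone (p q : unitInterval) (lam v : ℝ) :
    Monotone (continuation p q lam v) := by
  intro x y hxy
  rw [continuation_eq_max_affine, continuation_eq_max_affine]
  gcongr
  exacts [(unitInterval.symm p).2.1, (unitInterval.symm (p * unitInterval.symm q)).2.1]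

theorem exists_isBellmanSolution (p q : unitInterval) (lam : ℝ) (hr : 0 < r) (hr' : r < 1) :
    ∃ (θ : ℝ) (V : ℕ → ℝ), IsBellmanSolution p q r lam θ V := by
  obtain ⟨θ, V, hbdd, hV₀, hV⟩ := exists_bounded_backward_recursion
    (lipschitzWith_continuation p q lam 0) (summable_eaoii_sub hr hr')
  exact ⟨θ, V, isBellmanSolution_iff.2 ⟨hbdd, hV₀ ▸ hV⟩⟩

theorem exists_attainsMax (p q : unitInterval) (r lam : ℝ) (V : ℕ → ℝ) :
    ∃ d : ℕ → Bool, AttainsMax p q r lam V d := by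
  choose d hd using fun k => Finite.exists_max (actionValue p q r lam V k)
  exact ⟨d, hd⟩

end Bellman

section Threshold

variable {p q : unitInterval} {r lam θ : ℝ} {V : ℕ → ℝ} {d : ℕ → Bool}

theorem IsBellmanSolution.strictMono (h : IsBellmanSolution p q r lam θ V) (hr : 0 < r)
    (hr' : r < 2 / 3) : StrictMono V := by
  obtain ⟨⟨C, hC⟩, hV⟩ := isBellmanSolution_iff.1 h
  exact strictMono_of_backward_recursion (continuation_monotone p q lam (V 0))
    (lipschitzWith_continuation p q lam (V 0)) (eaoii_strictMono hr hr')
    ⟨-C, Set.forall_mem_range.2 fun k => neg_le_of_abs_le (hC k)⟩ hV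

theorem AttainsMax.le_gain (hd : AttainsMax p q r lam V d) (hV : ∃ C, ∀ k, |V k| ≤ C) {k : ℕ}
    (hk : d k = true) : lam ≤ p * q * (V (k + 1) - V 0) := by
  have := hd k false
  rw [hk, actionValue_true hV] at this
  linarith

theorem AttainsMax.gain_le (hd : AttainsMax p q r lam V d) (hV : ∃ C, ∀ k, |V k| ≤ C) {k : ℕ}
    (hk : d k = false) : p * q * (V (k + 1) - V 0) ≤ lam := by
  have := hd k true
  rw [hk, actionValue_true hV] at this
  linarith

theorem AttainsMax.monotone (hd : AttainsMax p q r lam V d) (hlam : lam ≠ 0)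
    (hbdd : ∃ C, ∀ k, |V k| ≤ C) (hV : StrictMono V) : Monotone d := by
  refine monotone_nat_of_le_succ fun k => Bool.le_iff_imp.2 fun hk => ?_
  by_contra hk'
  have hge := hd.le_gain hbdd hk
  have hle := hd.gain_le hbdd (Bool.eq_false_of_not_eq_true hk')
  have hlt : V (k + 1) < V (k + 1 + 1) := hV (k + 1).lt_succ_self
  have hpq : (p * q : ℝ) = 0 := by
    refine le_antisymm (le_of_not_gt fun hpos => ?_) (mul_nonneg p.2.1 q.2.1)
    linarith [mul_lt_mul_of_pos_left hlt hpos]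
  rw [hpq, zero_mul] at hge hle
  exact hlam (le_antisymm hge hle)

theorem isIncreasingThreshold_of_monotone (hs : StrictMono (eaoii r)) (hd : Monotone d) :
    IsIncreasingThreshold r d := by
  classical
  by_cases hex : ∃ n, d n = true
  · refine Or.inl ⟨Nat.find hex, fun k => ⟨fun hk => ?_, fun hk => ?_⟩⟩
    · exact Bool.eq_false_of_not_eq_true (Nat.find_min hex (hs.lt_iff_lt.1 hk))
    · exact Bool.le_iff_imp.1 (hd (hs.le_iff_le.1 hk)) (Nat.find_spec hex)
  · exact Or.inr fun k => Bool.eq_false_of_not_eq_true (not_exists.1 hex k)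

end Threshold

section Verification

variable {p q : unitInterval} {r lam θ : ℝ} {V : ℕ → ℝ} {d : ℕ → Bool}

/-- The expectation of `V(s(t))` under the policy `φ` with `s(0) = s_k`. -/
def expectedPotential (p q : unitInterval) (V : ℕ → ℝ) (φ : Policy) (k t : ℕ) : ℝ :=
  expect (historyLaw p q φ k t) fun h => V h.2

/-- The amount by which the action `x.2` in the state of index `x.1` falls short of the left-hand
side of the Bellman equation. -/
def bellmanLoss (p q : unitInterval) (r lam θ : ℝ) (V : ℕ → ℝ) (x : ℕ × Bool) : ℝ :=
  θ + V x.1 - actionValue p q r lam V x.1 x.2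

theorem IsBellmanSolution.bellmanLoss_nonneg (h : IsBellmanSolution p q r lam θ V)
    (x : ℕ × Bool) : 0 ≤ bellmanLoss p q r lam θ V x := by
  rw [bellmanLoss, sub_nonneg, h.2]
  cases x.2
  exacts [le_max_left _ _, le_max_right _ _]

theorem IsBellmanSolution.bellmanLoss_eq_zero (h : IsBellmanSolution p q r lam θ V)
    (hd : AttainsMax p q r lam V d) (k : ℕ) : bellmanLoss p q r lam θ V (k, d k) = 0 := by
  refine le_antisymm ?_ (h.bellmanLoss_nonneg _)
  rw [bellmanLoss, sub_nonpos, h.2]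
  exact max_le (hd k _) (hd k _)

theorem expect_stateActionLaw (φ : Policy) (k t : ℕ) {f : ℕ × Bool → ℝ} {C : ℝ}
    (hf : ∀ x, |f x| ≤ C) :
    expect (stateActionLaw p q φ k t) f =
      expect (historyLaw p q φ k t) fun h => expect (φ h) fun d => f (h.2, d) := by
  simp only [stateActionLaw, expect_bind _ _ hf, expect_map _ _ hf]

theorem snd_eq_of_mem_support_stateActionLaw {k t : ℕ} {x : ℕ × Bool}
    (hx : x ∈ (stateActionLaw p q (stationary d) k t).support) : x.2 = d x.1 := by
  simp only [stateActionLaw, stationary, PMF.pure_map, PMF.mem_support_bind_iff,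
    PMF.mem_support_pure_iff] at hx
  obtain ⟨h, -, rfl⟩ := hx
  rfl

theorem abs_expectedPotential_le {C : ℝ} (hC : ∀ k, |V k| ≤ C) (φ : Policy) (k t : ℕ) :
    |expectedPotential p q V φ k t| ≤ C :=
  abs_expect_le _ fun h => hC h.2

theorem expect_stateActionLaw_fst {C : ℝ} (hC : ∀ k, |V k| ≤ C) (φ : Policy) (k t : ℕ) :
    expect (stateActionLaw p q φ k t) (fun x => V x.1) = expectedPotential p q V φ k t := by
  simp only [expect_stateActionLaw φ k t fun x => hC x.1, expect_const, expectedPotential]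

theorem expect_stateActionLaw_transition {C : ℝ} (hC : ∀ k, |V k| ≤ C) (φ : Policy) (k t : ℕ) :
    expect (stateActionLaw p q φ k t) (fun x => expect (transition p q x.1 x.2) V) =
      expectedPotential p q V φ k (t + 1) := by
  have hC' (h : History) : |V h.2| ≤ C := hC h.2
  rw [expect_stateActionLaw φ k t fun x => abs_expect_le _ hC]
  simp only [expectedPotential, historyLaw, expect_bind _ _ hC', expect_map _ _ hC']

theorem abs_reward_le (hr : 0 < r) (hr' : r ≤ 1) (lam : ℝ) (k : ℕ) (d : Bool) :
    |reward r lam k d| ≤ 2 / r + |lam| := by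
  refine (abs_sub _ _).trans (add_le_add (abs_eaoii_le hr hr' k) ?_)
  cases d <;> simp

theorem abs_expectedReward_le (hr : 0 < r) (hr' : r ≤ 1) (lam : ℝ) (φ : Policy) (k t : ℕ) :
    |expectedReward p q r lam φ k t| ≤ 2 / r + |lam| :=
  abs_expect_le _ fun x => abs_reward_le hr hr' lam x.1 x.2

theorem expectedReward_eq_sub_expect_bellmanLoss (hr : 0 < r) (hr' : r ≤ 1)
    (hV : ∃ C, ∀ k, |V k| ≤ C) (lam θ : ℝ) (φ : Policy) (k t : ℕ) :
    expectedReward p q r lam φ k t =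
      θ + (expectedPotential p q V φ k t - expectedPotential p q V φ k (t + 1)) -
        expect (stateActionLaw p q φ k t) (bellmanLoss p q r lam θ V) := by
  obtain ⟨C, hC⟩ := hV
  set μ := stateActionLaw p q φ k t
  set drift : ℕ × Bool → ℝ := fun x => V x.1 - expect (transition p q x.1 x.2) V with hdrift
  have hE (x : ℕ × Bool) : |expect (transition p q x.1 x.2) V| ≤ C := abs_expect_le _ hC
  have hdrift_le (x : ℕ × Bool) : |drift x| ≤ C + C :=
    (abs_sub _ _).trans (add_le_add (hC x.1) (hE x))
  have hθ_le (x : ℕ × Bool) : |θ + drift x| ≤ |θ| + (C + C) :=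
    (abs_add_le _ _).trans (add_le_add_right (hdrift_le x) _)
  have hloss : bellmanLoss p q r lam θ V = fun x => θ + drift x - reward r lam x.1 x.2 := by
    funext x
    simp only [bellmanLoss, actionValue, hdrift]
    ring
  have hexpect : expect μ (bellmanLoss p q r lam θ V) =
      θ + (expect μ (fun x => V x.1) - expect μ fun x => expect (transition p q x.1 x.2) V) -
        expect μ fun x => reward r lam x.1 x.2 := by
    rw [hloss, expect_sub μ hθ_le fun x => abs_reward_le hr hr' lam x.1 x.2,
      expect_const_add μ θ hdrift_le, expect_sub μ (fun x => hC x.1) hE]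
  rw [hexpect, expect_stateActionLaw_fst hC, expect_stateActionLaw_transition hC, expectedReward,
    sub_sub_cancel]

theorem IsBellmanSolution.averageReward_le (h : IsBellmanSolution p q r lam θ V) (hr : 0 < r)
    (hr' : r ≤ 1) (φ : Policy) (k : ℕ) : averageReward p q r lam φ k ≤ θ := by
  obtain ⟨C, hC⟩ := h.1
  refine liminf_average_le (abs_expectedPotential_le (p := p) (q := q) hC φ k)
    (fun t => neg_le_of_abs_le (abs_expectedReward_le hr hr' lam φ k t)) fun t => ?_
  rw [expectedReward_eq_sub_expect_bellmanLoss hr hr' h.1 lam θ, sub_le_self_iff]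
  exact expect_nonneg _ h.bellmanLoss_nonneg

theorem IsBellmanSolution.averageReward_eq (h : IsBellmanSolution p q r lam θ V) (hr : 0 < r)
    (hr' : r ≤ 1) (hd : AttainsMax p q r lam V d) (k : ℕ) :
    averageReward p q r lam (stationary d) k = θ := by
  have hloss (t : ℕ) :
      expect (stateActionLaw p q (stationary d) k t) (bellmanLoss p q r lam θ V) = 0 :=
    expect_eq_zero _ fun x hx => by
      rw [← h.bellmanLoss_eq_zero hd x.1, ← snd_eq_of_mem_support_stateActionLaw hx]
  obtain ⟨C, hC⟩ := h.1
  simp only [averageReward, expectedReward_eq_sub_expect_bellmanLoss hr hr' h.1 lam θ, hloss,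
    sub_zero]
  exact (tendsto_average_const_add_sub_succ θ (abs_expectedPotential_le hC _ k)).liminf_eq

theorem IsBellmanSolution.isGreatest_averageReward (h : IsBellmanSolution p q r lam θ V)
    (hr : 0 < r) (hr' : r ≤ 1) (k : ℕ) :
    IsGreatest (Set.range fun φ : Policy => averageReward p q r lam φ k) θ := by
  obtain ⟨d, hd⟩ := exists_attainsMax p q r lam V
  exact ⟨⟨stationary d, h.averageReward_eq hr hr' hd k⟩,
    Set.forall_mem_range.2 fun φ => h.averageReward_le hr hr' φ k⟩

end Verification

end EAoII

end

theorem theorem1_general (p q : unitInterval) (r lam : ℝ) (hr : 0 < r) (hr' : r < 2 / 3)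
    (hlam : lam ≠ 0) :
    (∃ (θ : ℝ) (V : ℕ → ℝ), EAoII.IsBellmanSolution p q r lam θ V) ∧
    ∀ (θ : ℝ) (V : ℕ → ℝ), EAoII.IsBellmanSolution p q r lam θ V →
      (∀ k : ℕ, IsGreatest
        (Set.range fun φ : EAoII.Policy => EAoII.averageReward p q r lam φ k) θ) ∧
      (∃ d : ℕ → Bool, EAoII.AttainsMax p q r lam V d) ∧
      ∀ d : ℕ → Bool, EAoII.AttainsMax p q r lam V d →
        EAoII.IsIncreasingThreshold r d ∧
        ∀ k : ℕ, EAoII.averageReward p q r lam (EAoII.stationary d) k = θ := by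
  have hr₁ : r < 1 := by linarith
  refine ⟨EAoII.exists_isBellmanSolution p q lam hr hr₁, fun θ V h =>
    ⟨h.isGreatest_averageReward hr hr₁.le, EAoII.exists_attainsMax p q r lam V, fun d hd =>
      ⟨?_, h.averageReward_eq hr hr₁.le hd⟩⟩⟩
  exact EAoII.isIncreasingThreshold_of_monotone (EAoII.eaoii_strictMono hr hr')
    (hd.monotone hlam h.1 (h.strictMono hr hr'))

theorem theorem1 (p q : unitInterval) (r lam : ℝ) (hr : 0 < r) (hr2 : r ≤ 1 / 2)
    (hlam : 0 < lam) :
    (∃ (θ : ℝ) (V : ℕ → ℝ), EAoII.IsBellmanSolution p q r lam θ V) ∧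
    ∀ (θ : ℝ) (V : ℕ → ℝ), EAoII.IsBellmanSolution p q r lam θ V →
      (∀ k : ℕ, IsGreatest
        (Set.range fun φ : EAoII.Policy => EAoII.averageReward p q r lam φ k) θ) ∧
      (∃ d : ℕ → Bool, EAoII.AttainsMax p q r lam V d) ∧
      ∀ d : ℕ → Bool, EAoII.AttainsMax p q r lam V d →
        EAoII.IsIncreasingThreshold r d ∧
        ∀ k : ℕ, EAoII.averageReward p q r lam (EAoII.stationary d) k = θ :=
  theorem1_general p q r lam hr (by linarith) hlam.ne'
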